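/- All manifolds are Hausdorff, finite-dimensional, $C^\infty$ and without boundary. Let $G$ be a Lie group with Lie algebra $\mathfrak g=T_eG$, whose bracket is that of left-invariant vector fields, and let $\pi:P\to M$ be a smooth principal bundle with structure group $G$: $\pi$ is smooth, $G$ acts smoothly and freely on $P$ on the right, the action preserves each fibre of $\pi$ and is transitive on it, and around every point of $M$ there are an open set $U$ and a diffeomorphism $\pi^{-1}(U)\to U\times G$ of the form $p\mapsto(\pi(p),s(p))$ with $s(pg)=s(p)g$. For $A\in\mathfrak g$ let $A^*$ be the fundamental vector field $A^*_p=\frac{d}{dt}\big|_{t=0}\,p\cdot\exp(tA)$, and for $g\in G$ let $R_g(p)=pg$. Let $\omega$ be a connection form on $P$, that is, a smooth $\mathfrak g$-valued $1$-form on $P$ such that $$\omega(A^*_p)=A,\qquad \omega_{pg}\big((R_g)_*X\big)=\mathrm{Ad}_{g^{-1}}\big(\omega_p(X)\big)$$ for all $A\in\mathfrak g$, $g\in G$, $p\in P$ and $X\in T_pP$. Put $V_p=\ker(\pi_*)_p$ and $H_p=\ker\omega_p$, so that $T_pP=H_p\oplus V_p$, and let $X\mapsto X^H$ be the projection of $T_pP$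 onto $H_p$ along $V_p$. The exterior covariant derivative of a $\mathfrak g$-valued $k$-form $\alpha$ on $P$ is $$d^H\alpha(X_1,\dots,X_{k+1})=d\alpha(X_1^H,\dots,X_{k+1}^H),$$ and the curvature of $\omega$ is the $2$-form $\Omega^\omega=d^H\omega$. Here $d$ is normalized so that $d\alpha(X,Y)=X[\alpha(Y)]-Y[\alpha(X)]-\alpha([X,Y])$ for $1$-forms. The bracket of a $\mathfrak g$-valued $i$-form $\varphi$ and a $\mathfrak g$-valued $j$-form $\psi$ is $$[\varphi,\psi](X_1,\dots,X_{i+j})=\frac1{i!\,j!}\sum_{\sigma\in S_{i+j}}\operatorname{sgn}(\sigma)\,\big[\varphi(X_{\sigma(1)},\dots,X_{\sigma(i)}),\psi(X_{\sigma(i+1)},\dots,X_{\sigma(i+j)})\big].$$ Then the structure equation holds, as an equality of $\mathfrak g$-valued $2$-forms on $P$: $$\Omega^\omega=d\omega+\tfrac12[\omega,\omega].$$ -/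

import Mathlib

open scoped Manifold ContDiff

noncomputable section

/-! ### Differential forms on a manifold -/

section Forms

variable {E : Type*} [NormedAddCommGroup E] [NormedSpace ℝ E]
  {H : Type*} [TopologicalSpace H] (I : ModelWithCorners ℝ E H)
  {M : Type*} [TopologicalSpace M] [ChartedSpace H M]
  {F : Type*} [NormedAddCommGroup F] [NormedSpace ℝ F] {k : ℕ}

variable (M F) in
/-- A (not necessarily smooth) field of alternating `k`-forms on `M` with values in the vector
space `F`: at each point `x`, an alternating `k`-linear map on the tangent space at `x`. -/
abbrev DForm (k : ℕ) := ∀ x : M, TangentSpace I x [⋀^Fin k]→L[ℝ] F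

/-- The expression of a form in the preferred chart around `x₀`, i.e. its pullback under the inverse
of that chart. It is a form on (the target of the chart in) the model vector space `E`. -/
def formInChart (x₀ : M) (α : DForm I M F k) (y : E) : E [⋀^Fin k]→L[ℝ] F :=
  (α ((extChartAt I x₀).symm y)).compContinuousLinearMap
    (mfderiv 𝓘(ℝ, E) I (extChartAt I x₀).symm y)

/-- A form is smooth if all its expressions in charts are `C^∞`. -/
def IsSmoothForm (α : DForm I M F k) : Prop :=
  ∀ x₀ : M, ContDiffOn ℝ ∞ (formInChart I x₀ α) (extChartAt I x₀).target

/-- The exterior derivative `dα` of a `k`-form `α` on a manifold without boundary: at `x`, take the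
exterior derivative (in the vector space `E`) of the expression of `α` in the chart around `x`, and
pull it back under the chart. The normalization is that of `extDeriv`, so that
`dα(X, Y) = X[α(Y)] - Y[α(X)] - α([X, Y])` for a `1`-form `α`. -/
def mextDeriv (α : DForm I M F k) : DForm I M F (k + 1) := fun x ↦
  (extDeriv (formInChart I x α) (extChartAt I x x)).compContinuousLinearMap
    (mfderiv I 𝓘(ℝ, E) (extChartAt I x) x)

/-- The value `α_x(v)` of a `1`-form on a single vector, as a linear map of `v`. -/
def DForm.lin (α : DForm I M F 1) (x : M) : TangentSpace I x →L[ℝ] F :=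
  (ContinuousAlternatingMap.ofSubsingleton ℝ (TangentSpace I x) F (0 : Fin 1)).symm (α x)

theorem DForm.lin_apply (α : DForm I M F 1) (x : M) (v : TangentSpace I x) :
    DForm.lin I α x v = α x (fun _ ↦ v) := rfl

end Forms

/-! ### The Lie algebra of a Lie group

The Lie algebra `𝔤 = T_1 G` (`GroupLieAlgebra IG G` in Mathlib) is by definition the model vector
space `EG` of `G`. Forms with values in `𝔤` are therefore written as forms with values in `EG`. -/

section LieAlgebra

variable {EG : Type*} [NormedAddCommGroup EG] [NormedSpace ℝ EG]
  {HG : Type*} [TopologicalSpace HG] (IG : ModelWithCorners ℝ EG HG)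
  (G : Type*) [TopologicalSpace G] [ChartedSpace HG G] [Group G]

variable {G} in
/-- The adjoint representation: `Ad_g : 𝔤 → 𝔤` is the differential at `1` of `h ↦ g h g⁻¹`. -/
def adjointRep (g : G) : EG →L[ℝ] EG :=
  mfderiv IG IG (fun h : G ↦ g * h * g⁻¹) 1

/-- The Lie bracket of `𝔤`, i.e. the bracket of left-invariant vector fields, as a bilinear map. -/
def lieBracketLin [FiniteDimensional ℝ EG] [LieGroup IG ∞ G] :
    GroupLieAlgebra IG G →ₗ[ℝ] GroupLieAlgebra IG G →ₗ[ℝ] GroupLieAlgebra IG G :=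
  haveI : LieGroup IG (minSmoothness ℝ 3) G := LieGroup.of_le (n := ∞) (by
    simp only [minSmoothness_of_isRCLikeNormedField]
    exact ENat.LEInfty.out)
  haveI : CompleteSpace EG := FiniteDimensional.complete ℝ EG
  LinearMap.mk₂ ℝ (fun a b : GroupLieAlgebra IG G ↦ ⁅a, b⁆) add_lie smul_lie lie_add
    (fun t a b ↦ lie_smul t a b)

/-- The Lie bracket of `𝔤` as a continuous bilinear map. -/
def lieBracketL [FiniteDimensional ℝ EG] [LieGroup IG ∞ G] : EG →L[ℝ] EG →L[ℝ] EG :=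
  LinearMap.toContinuousBilinearMap (E := EG) (F := EG) (G := EG) (lieBracketLin IG G)

theorem lieBracketL_apply [FiniteDimensional ℝ EG] [LieGroup IG ∞ G] (a b : EG) :
    lieBracketL IG G a b =
      Bracket.bracket (L := GroupLieAlgebra IG G) (M := GroupLieAlgebra IG G) a b := rfl

section Update

variable {V : Type*} {i j : ℕ}

theorem update_castAdd_left [DecidableEq (Fin (i + j))] (v : Fin (i + j) → V) (a : Fin i) (x : V) :
    (fun a' ↦ Function.update v (Fin.castAdd j a) x (Fin.castAdd j a')) =
      Function.update (fun a' ↦ v (Fin.castAdd j a')) a x := by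
  ext a'
  by_cases h : a' = a
  · subst h; simp
  · have : Fin.castAdd j a' ≠ Fin.castAdd j a := fun hh ↦ h (Fin.castAdd_injective i j hh)
    simp [Function.update_of_ne, h, this]

theorem update_castAdd_right [DecidableEq (Fin (i + j))] (v : Fin (i + j) → V) (a : Fin i) (x : V) :
    (fun b ↦ Function.update v (Fin.castAdd j a) x (Fin.natAdd i b)) =
      fun b ↦ v (Fin.natAdd i b) := by
  ext b
  have : Fin.natAdd i b ≠ Fin.castAdd j a := by
    intro hh
    have := congrArg Fin.val hh
    simp at this
    omega
  simp [Function.update_of_ne, this]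

theorem update_natAdd_left [DecidableEq (Fin (i + j))] (v : Fin (i + j) → V) (b : Fin j) (x : V) :
    (fun a ↦ Function.update v (Fin.natAdd i b) x (Fin.castAdd j a)) =
      fun a ↦ v (Fin.castAdd j a) := by
  ext a
  have : Fin.castAdd j a ≠ Fin.natAdd i b := by
    intro hh
    have := congrArg Fin.val hh
    simp at this
    omega
  simp [Function.update_of_ne, this]

theorem update_natAdd_right [DecidableEq (Fin (i + j))] (v : Fin (i + j) → V) (b : Fin j) (x : V) :
    (fun b' ↦ Function.update v (Fin.natAdd i b) x (Fin.natAdd i b')) =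
      Function.update (fun b' ↦ v (Fin.natAdd i b')) b x := by
  ext b'
  by_cases h : b' = b
  · subst h; simp
  · have : Fin.natAdd i b' ≠ Fin.natAdd i b := fun hh ↦ h (by simpa using hh)
    simp [Function.update_of_ne, h, this]

end Update

/-- Pointwise bracket of alternating maps with values in `𝔤`:
`[α, β](v₁, …, v_{i+j})
  = 1/(i! j!) ∑_σ sgn(σ) [α(v_{σ(1)}, …, v_{σ(i)}), β(v_{σ(i+1)}, …, v_{σ(i+j)})]`. -/
def alternatingBracket [FiniteDimensional ℝ EG] [LieGroup IG ∞ G]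
    {V : Type*} [AddCommGroup V] [Module ℝ V] [TopologicalSpace V] {i j : ℕ}
    (α : V [⋀^Fin i]→L[ℝ] EG) (β : V [⋀^Fin j]→L[ℝ] EG) : V [⋀^Fin (i + j)]→L[ℝ] EG :=
  (1 / ((i.factorial : ℝ) * (j.factorial : ℝ))) • ContinuousMultilinearMap.alternatization
    { toFun := fun v ↦ lieBracketL IG G (α fun a ↦ v (Fin.castAdd j a)) (β fun b ↦ v (Fin.natAdd i b))
      map_update_add' := fun v c x y ↦ by
        obtain ⟨s, rfl⟩ := finSumFinEquiv.surjective c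
        rcases s with a | b
        · simp [update_castAdd_left, update_castAdd_right]
        · simp [update_natAdd_left, update_natAdd_right]
      map_update_smul' := fun v c t x ↦ by
        obtain ⟨s, rfl⟩ := finSumFinEquiv.surjective c
        rcases s with a | b
        · simp [update_castAdd_left, update_castAdd_right]
        · simp [update_natAdd_left, update_natAdd_right]
      cont := by
        have h₁ : Continuous fun v : Fin (i + j) → V ↦ α fun a ↦ v (Fin.castAdd j a) :=
          α.cont.comp (by fun_prop)
        have h₂ : Continuous fun v : Fin (i + j) → V ↦ β fun b ↦ v (Fin.natAdd i b) :=
          β.cont.comp (by fun_prop)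
        exact ((lieBracketL IG G).continuous.comp h₁).clm_apply h₂ }

theorem alternatingBracket_apply [FiniteDimensional ℝ EG] [LieGroup IG ∞ G]
    {V : Type*} [AddCommGroup V] [Module ℝ V] [TopologicalSpace V] {i j : ℕ}
    (α : V [⋀^Fin i]→L[ℝ] EG) (β : V [⋀^Fin j]→L[ℝ] EG) (v : Fin (i + j) → V) :
    alternatingBracket IG G α β v = (1 / ((i.factorial : ℝ) * (j.factorial : ℝ))) •
      ∑ σ : Equiv.Perm (Fin (i + j)), Equiv.Perm.sign σ •
        lieBracketL IG G (α fun a ↦ v (σ (Fin.castAdd j a))) (β fun b ↦ v (σ (Fin.natAdd i b))) := by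
  simp only [alternatingBracket, ContinuousAlternatingMap.smul_apply,
    ContinuousMultilinearMap.alternatization_apply_apply]
  rfl

/-- The bracket `[α, β]` of two `𝔤`-valued forms on a manifold. -/
def formBracket [FiniteDimensional ℝ EG] [LieGroup IG ∞ G]
    {E : Type*} [NormedAddCommGroup E] [NormedSpace ℝ E]
    {H : Type*} [TopologicalSpace H] (I : ModelWithCorners ℝ E H)
    {M : Type*} [TopologicalSpace M] [ChartedSpace H M] {i j : ℕ}
    (α : DForm I M EG i) (β : DForm I M EG j) : DForm I M EG (i + j) :=
  fun x ↦ alternatingBracket IG G (α x) (β x)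

end LieAlgebra

/-! ### Principal bundles and connections -/

section Principal

variable {EM : Type*} [NormedAddCommGroup EM] [NormedSpace ℝ EM]
  {HM : Type*} [TopologicalSpace HM] (IM : ModelWithCorners ℝ EM HM)
  {M : Type*} [TopologicalSpace M] [ChartedSpace HM M]
  {EG : Type*} [NormedAddCommGroup EG] [NormedSpace ℝ EG]
  {HG : Type*} [TopologicalSpace HG] (IG : ModelWithCorners ℝ EG HG)
  (G : Type*) [TopologicalSpace G] [ChartedSpace HG G] [Group G]
  {EP : Type*} [NormedAddCommGroup EP] [NormedSpace ℝ EP]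
  {HP : Type*} [TopologicalSpace HP] (IP : ModelWithCorners ℝ EP HP)
  {P : Type*} [TopologicalSpace P] [ChartedSpace HP P] [MulAction Gᵐᵒᵖ P]

/-- `π : P → M` is a smooth principal bundle with structure group `G`. The right action of `G` on
`P` is written as an action of the opposite group: `p · g` is `MulOpposite.op g • p`. -/
structure IsPrincipalBundle (π : P → M) : Prop where
  contMDiff_proj : ContMDiff IP IM ∞ π
  contMDiff_act : ContMDiff (IP.prod IG) IP ∞ (fun q : P × G ↦ MulOpposite.op q.2 • q.1)
  /-- The action preserves the fibres of `π` and is transitive on each of them. -/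
  proj_eq_iff : ∀ p q : P, π p = π q ↔ ∃ g : G, MulOpposite.op g • p = q
  /-- The action is free. -/
  free : ∀ (p : P) (g : G), MulOpposite.op g • p = p → g = 1
  /-- Around every point of `M` there are an open set `U` and a diffeomorphism
  `π⁻¹(U) → U × G`, `p ↦ (π(p), s(p))` with `s(p · g) = s(p) g`. -/
  locally_trivial : ∀ x : M, ∃ e : Bundle.Trivialization G π, x ∈ e.baseSet ∧
    ContMDiffOn IP (IM.prod IG) ∞ e e.source ∧
    ContMDiffOn (IM.prod IG) IP ∞ e.toOpenPartialHomeomorph.symm e.target ∧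
    ∀ p ∈ e.source, ∀ g : G, (e (MulOpposite.op g • p)).2 = (e p).2 * g

/-- The fundamental vector field `A^*` of `A ∈ 𝔤`: `A^*_p` is the image of `A` under the
differential at `1` of `g ↦ p · g`, that is `A^*_p = d/dt|_{t=0} p · exp(tA)`
(see `hasMFDerivAt_fundamentalField`). -/
def fundamentalField (A : EG) (p : P) : TangentSpace IP p :=
  mfderiv IG IP (fun g : G ↦ MulOpposite.op g • p) 1 A

variable {IM IG G IP}

/-- Every orbit map `g ↦ p · g` is smooth. -/
theorem IsPrincipalBundle.contMDiff_orbit {π : P → M} (hP : IsPrincipalBundle IM IG G IP π)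
    (p : P) : ContMDiff IG IP ∞ (fun g : G ↦ MulOpposite.op g • p) :=
  hP.contMDiff_act.comp (contMDiff_const.prodMk contMDiff_id)

/-- `A^*_p` is the velocity at `t = 0` of `t ↦ p · γ(t)`, where `γ(t) = exp(tA)` is the integral
curve through `1` of the left-invariant vector field of `A`. -/
theorem IsPrincipalBundle.hasMFDerivAt_fundamentalField {π : P → M}
    (hP : IsPrincipalBundle IM IG G IP π) (A : EG) (p : P) (γ : ℝ → G)
    (hγ : IsMIntegralCurve (I := IG) γ
      (mulInvariantVectorField (I := IG) (G := G) (A : GroupLieAlgebra IG G))) (h0 : γ 0 = 1) :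
    HasMFDerivAt 𝓘(ℝ, ℝ) IP (fun t : ℝ ↦ MulOpposite.op (γ t) • p) 0
      ((1 : ℝ →L[ℝ] ℝ).smulRight (fundamentalField IG G IP A p : EP)) := by
  have h1 := hγ 0
  have h2 : HasMFDerivAt IG IP (fun g : G ↦ MulOpposite.op g • p) (γ 0)
      (mfderiv IG IP (fun g : G ↦ MulOpposite.op g • p) (γ 0)) :=
    (((hP.contMDiff_orbit p).mdifferentiable (by simp)) (γ 0)).hasMFDerivAt
  have h3 := h2.comp (0 : ℝ) h1
  have h4 : ∀ g : G, g = 1 →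
      ((mfderiv IG IP (fun g : G ↦ MulOpposite.op g • p) g : EG →L[ℝ] EP)
        (mfderiv IG IG (g * ·) (1 : G) A : EG)) = fundamentalField IG G IP A p := by
    rintro _ rfl
    have hk : ∀ f : G → G, f = id →
        (mfderiv IG IG f 1 : EG →L[ℝ] EG) = ContinuousLinearMap.id ℝ EG := by
      rintro _ rfl
      exact mfderiv_id
    rw [hk (fun x ↦ 1 * x) (by funext; simp)]
    rfl
  refine h3.congr_mfderiv ?_
  refine ContinuousLinearMap.ext_ring (?_ : _ = (1 : ℝ) • (fundamentalField IG G IP A p : EP))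
  rw [one_smul, ← h4 (γ 0) h0]
  change (mfderiv IG IP (fun g : G ↦ MulOpposite.op g • p) (γ 0) : EG →L[ℝ] EP)
    ((1 : ℝ) • (mfderiv IG IG ((γ 0) * ·) (1 : G) A : EG)) = _
  rw [one_smul]

/-- The differential of `π` kills the fundamental vector fields. -/
theorem IsPrincipalBundle.mfderiv_proj_fundamentalField {π : P → M}
    (hP : IsPrincipalBundle IM IG G IP π) (A : EG) (p : P) :
    mfderiv IP IM π p (fundamentalField IG G IP A p) = 0 := by
  have hc : (fun g : G ↦ π (MulOpposite.op g • p)) = fun _ ↦ π p := by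
    funext g
    exact ((hP.proj_eq_iff p _).2 ⟨g, rfl⟩).symm
  have h1 : HasMFDerivAt IG IP (fun g : G ↦ MulOpposite.op g • p) 1
      (mfderiv IG IP (fun g : G ↦ MulOpposite.op g • p) 1) :=
    (((hP.contMDiff_orbit p).mdifferentiable (by simp)) 1).hasMFDerivAt
  have h2 := ((hP.contMDiff_proj.mdifferentiable (by simp))
    (MulOpposite.op (1 : G) • p)).hasMFDerivAt.comp (1 : G) h1
  have h3 := h2.mfderiv
  have h4 : mfderiv IG IM (π ∘ fun g : G ↦ MulOpposite.op g • p) 1 = 0 := by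
    change mfderiv IG IM (fun g : G ↦ π (MulOpposite.op g • p)) 1 = 0
    rw [hc]
    exact mfderiv_const
  have key : ∀ q : P, q = p →
      (mfderiv IP IM π q : EP →L[ℝ] EM) = (mfderiv IP IM π p : EP →L[ℝ] EM) := by
    rintro _ rfl
    rfl
  have h5 := key (MulOpposite.op (1 : G) • p) (by simp)
  have h6 : ((mfderiv IP IM π (MulOpposite.op (1 : G) • p) : EP →L[ℝ] EM)
      (mfderiv IG IP (fun g : G ↦ MulOpposite.op g • p) 1 A : EP)) = 0 :=
    (congrArg (fun L : EG →L[ℝ] EM ↦ L A) h3).symm.trans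
      (congrArg (fun L : EG →L[ℝ] EM ↦ L A) h4)
  rw [h5] at h6
  exact h6

/-- Every vector in the kernel of the differential of `π` is the value of a fundamental field. -/
theorem IsPrincipalBundle.exists_fundamentalField_eq [LieGroup IG ∞ G] {π : P → M}
    (hP : IsPrincipalBundle IM IG G IP π) (p : P) (X : TangentSpace IP p)
    (hX : mfderiv IP IM π p X = 0) : ∃ A : EG, fundamentalField IG G IP A p = X := by
  obtain ⟨e, hx, he, he', hequiv⟩ := hP.locally_trivial (π p)
  have hp : p ∈ e.source := e.mem_source.2 hx
  have hpo := e.open_source.mem_nhds hp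
  let s : P → G := fun q ↦ (e q).2
  let τ : M → P := fun x ↦ e.toOpenPartialHomeomorph.symm (x, s p)
  let k : P → G := fun q ↦ (s p)⁻¹ * s q
  have hs : MDifferentiableAt IP IG s p :=
    ((contMDiff_snd.contMDiffAt.comp p ((he p hp).contMDiffAt hpo)).mdifferentiableAt (by simp))
  have hk : MDifferentiableAt IP IG k p := by
    have h : ContMDiff IG IG ∞ (fun h : G ↦ (s p)⁻¹ * h) := contMDiff_mul_left
    exact (h.mdifferentiable (by simp) (s p)).comp p hs
  have ht : (π p, s p) ∈ e.target := e.mem_target.2 hx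
  have hτ : MDifferentiableAt IM IP τ (π p) :=
    (((he' _ ht).contMDiffAt (e.open_target.mem_nhds ht)).comp (π p)
      (contMDiffAt_id.prodMk contMDiffAt_const)).mdifferentiableAt (by simp)
  have hπ : MDifferentiableAt IP IM π p := hP.contMDiff_proj.mdifferentiable (by simp) p
  have hr : HasMFDerivAt IP IP (τ ∘ π) p ((mfderiv IM IP τ (π p)).comp (mfderiv IP IM π p)) :=
    hτ.hasMFDerivAt.comp p hπ.hasMFDerivAt
  have hrp : (τ ∘ π) p = p := by
    change e.toOpenPartialHomeomorph.symm (π p, (e p).2) = p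
    have : (π p, (e p).2) = e p := Prod.ext (e.proj_toFun p hp).symm rfl
    rw [this]
    exact e.left_inv hp
  have hkp : k p = 1 := inv_mul_cancel _
  -- near `p`, every `q` is `r(q) · k(q)`
  have hid : (fun q : P ↦ MulOpposite.op (k q) • (τ ∘ π) q) =ᶠ[nhds p] id := by
    filter_upwards [hpo] with q hq
    have hqb : π q ∈ e.baseSet := e.mem_source.1 hq
    have hqt : (π q, s p) ∈ e.target := e.mem_target.2 hqb
    have hrs : (τ ∘ π) q ∈ e.source := e.map_target hqt
    have her : e ((τ ∘ π) q) = (π q, s p) := e.right_inv hqt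
    have hπr : π ((τ ∘ π) q) = π q := by
      rw [← e.proj_toFun _ hrs]
      exact congrArg Prod.fst her
    have hπa : π (MulOpposite.op (k q) • (τ ∘ π) q) = π q :=
      ((hP.proj_eq_iff _ _).2 ⟨k q, rfl⟩).symm.trans hπr
    have has : MulOpposite.op (k q) • (τ ∘ π) q ∈ e.source :=
      e.mem_source.2 (by rw [hπa]; exact hqb)
    refine e.injOn has hq (Prod.ext ?_ ?_)
    · exact (e.proj_toFun _ has).trans (hπa.trans (e.proj_toFun _ hq).symm)
    · refine (hequiv _ hrs (k q)).trans ?_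
      rw [show (e ((τ ∘ π) q)).2 = s p from (congrArg Prod.snd her : _)]
      exact mul_inv_cancel_left _ _
  have hact : ∀ y : P × G, MDifferentiableAt (IP.prod IG) IP
      (fun q : P × G ↦ MulOpposite.op q.2 • q.1) y :=
    fun y ↦ hP.contMDiff_act.mdifferentiable (by simp) y
  have h1 : HasMFDerivAt IP IP (fun q : P ↦ MulOpposite.op (k q) • (τ ∘ π) q) p
      ((mfderiv (IP.prod IG) IP (fun q : P × G ↦ MulOpposite.op q.2 • q.1) ((τ ∘ π) p, k p)).comp
        (((mfderiv IM IP τ (π p)).comp (mfderiv IP IM π p)).prod (mfderiv IP IG k p))) :=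
    (hact ((τ ∘ π) p, k p)).hasMFDerivAt.comp p (hr.prodMk hk.hasMFDerivAt)
  have h2 : HasMFDerivAt IG IP (fun g : G ↦ MulOpposite.op g • p) 1
      ((mfderiv (IP.prod IG) IP (fun q : P × G ↦ MulOpposite.op q.2 • q.1) (p, 1)).comp
        ((0 : TangentSpace IG (1 : G) →L[ℝ] TangentSpace IP p).prod
          (ContinuousLinearMap.id ℝ (TangentSpace IG (1 : G))))) :=
    (hact (p, 1)).hasMFDerivAt.comp (1 : G) ((hasMFDerivAt_const p 1).prodMk (hasMFDerivAt_id 1))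
  have key : ∀ y : P × G, y = (p, 1) →
      (mfderiv (IP.prod IG) IP (fun q : P × G ↦ MulOpposite.op q.2 • q.1) y : EP × EG →L[ℝ] EP) =
        (mfderiv (IP.prod IG) IP (fun q : P × G ↦ MulOpposite.op q.2 • q.1) (p, 1) :
          EP × EG →L[ℝ] EP) := by
    rintro _ rfl
    rfl
  have h3 : (mfderiv IP IP (fun q : P ↦ MulOpposite.op (k q) • (τ ∘ π) q) p : EP →L[ℝ] EP) =
      ContinuousLinearMap.id ℝ EP := hid.mfderiv_eq.trans mfderiv_id
  refine ⟨(mfderiv IP IG k p : EP →L[ℝ] EG) X, ?_⟩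
  have h4 : (mfderiv (IP.prod IG) IP (fun q : P × G ↦ MulOpposite.op q.2 • q.1)
      ((τ ∘ π) p, k p) : EP × EG →L[ℝ] EP)
        ((mfderiv IM IP τ (π p) : EM →L[ℝ] EP) ((mfderiv IP IM π p : EP →L[ℝ] EM) X),
          (mfderiv IP IG k p : EP →L[ℝ] EG) X) = X :=
    (congrArg (fun L : EP →L[ℝ] EP ↦ L X) h1.mfderiv).symm.trans
      (congrArg (fun L : EP →L[ℝ] EP ↦ L X) h3)
  have hX' : (mfderiv IP IM π p : EP →L[ℝ] EM) X = 0 := hX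
  rw [key _ (Prod.ext hrp hkp), hX', map_zero] at h4
  refine Eq.trans ?_ h4
  exact congrArg (fun L : EG →L[ℝ] EP ↦ L ((mfderiv IP IG k p : EP →L[ℝ] EG) X)) h2.mfderiv

variable (IG G IP) in
/-- A connection form on the principal bundle `P` (with its right action of `G`): a smooth
`𝔤`-valued `1`-form `θ` with `θ(A^*) = A` for all `A ∈ 𝔤` and `R_g^* θ = Ad_{g⁻¹} θ` for all
`g ∈ G`, where `R_g(p) = p · g`. -/
structure IsConnectionForm (θ : DForm IP P EG 1) : Prop where
  smooth : IsSmoothForm IP θ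
  apply_fundamentalField : ∀ (A : EG) (p : P),
    θ p (fun _ ↦ fundamentalField IG G IP A p) = A
  equivariant : ∀ (g : G) (p : P) (X : TangentSpace IP p),
    θ (MulOpposite.op g • p)
        (fun _ ↦ mfderiv IP IP (fun q : P ↦ MulOpposite.op g • q) p X) =
      adjointRep IG g⁻¹ (θ p (fun _ ↦ X))

variable (IM) in
/-- The vertical subspace `V_p = {X ∈ T_p P | π_* X = 0}`. -/
def verticalSpace (IP : ModelWithCorners ℝ EP HP) (π : P → M) (p : P) :
    Submodule ℝ (TangentSpace IP p) :=
  LinearMap.ker (mfderiv IP IM π p : TangentSpace IP p →ₗ[ℝ] TangentSpace IM (π p))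

/-- The horizontal subspace `H_p = ker θ_p`. -/
def horizontalSpace (θ : DForm IP P EG 1) (p : P) : Submodule ℝ (TangentSpace IP p) :=
  LinearMap.ker (DForm.lin IP θ p : TangentSpace IP p →ₗ[ℝ] EG)

/-- A connection form gives a decomposition `T_p P = H_p ⊕ V_p`. -/
theorem isCompl_horizontalSpace_verticalSpace [LieGroup IG ∞ G] {π : P → M} (hP : IsPrincipalBundle IM IG G IP π)
    {θ : DForm IP P EG 1} (hθ : IsConnectionForm IG G IP θ) (p : P) :
    IsCompl (horizontalSpace θ p) (verticalSpace IM IP π p) := by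
  refine IsCompl.of_eq ?_ ?_
  · rw [eq_bot_iff]
    rintro X ⟨hX, hX'⟩
    obtain ⟨A, rfl⟩ := hP.exists_fundamentalField_eq p X hX'
    have h : A = 0 := (hθ.apply_fundamentalField A p).symm.trans hX
    subst h
    exact map_zero (mfderiv IG IP (fun g : G ↦ MulOpposite.op g • p) 1)
  · rw [eq_top_iff]
    intro X _
    rw [← sub_add_cancel X (fundamentalField IG G IP (θ p fun _ ↦ X) p)]
    refine Submodule.add_mem_sup ?_ (hP.mfderiv_proj_fundamentalField _ p)
    change DForm.lin IP θ p _ = 0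
    rw [map_sub, sub_eq_zero]
    exact (hθ.apply_fundamentalField _ p).symm

/-- The horizontal part `X ↦ X^H`: the projection of `T_p P` onto `H_p` along `V_p`. -/
def horizontalPart [LieGroup IG ∞ G] [FiniteDimensional ℝ EP] {π : P → M} (hP : IsPrincipalBundle IM IG G IP π)
    {θ : DForm IP P EG 1} (hθ : IsConnectionForm IG G IP θ) (p : P) :
    TangentSpace IP p →L[ℝ] TangentSpace IP p :=
  haveI : FiniteDimensional ℝ (TangentSpace IP p) := inferInstanceAs (FiniteDimensional ℝ EP)
  haveI : T2Space (TangentSpace IP p) := inferInstanceAs (T2Space EP)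
  LinearMap.toContinuousLinearMap
    ((horizontalSpace θ p).projection (verticalSpace IM IP π p)
      (isCompl_horizontalSpace_verticalSpace hP hθ p))

/-- In terms of the fundamental fields, `X^H = X - (θ(X))^*`. -/
theorem horizontalPart_apply [LieGroup IG ∞ G] [FiniteDimensional ℝ EP] {π : P → M}
    (hP : IsPrincipalBundle IM IG G IP π)
    {θ : DForm IP P EG 1} (hθ : IsConnectionForm IG G IP θ) (p : P) (X : TangentSpace IP p) :
    horizontalPart hP hθ p X = X - fundamentalField IG G IP (θ p fun _ ↦ X) p := by
  have hH : X - fundamentalField IG G IP (θ p fun _ ↦ X) p ∈ horizontalSpace θ p := by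
    change DForm.lin IP θ p _ = 0
    rw [map_sub, sub_eq_zero]
    exact (hθ.apply_fundamentalField _ p).symm
  have hV : fundamentalField IG G IP (θ p fun _ ↦ X) p ∈ verticalSpace IM IP π p :=
    hP.mfderiv_proj_fundamentalField _ p
  change (horizontalSpace θ p).projection (verticalSpace IM IP π p)
      (isCompl_horizontalSpace_verticalSpace hP hθ p) X = _
  conv_lhs => rw [← sub_add_cancel X (fundamentalField IG G IP (θ p fun _ ↦ X) p)]
  rw [map_add, Submodule.projection_apply_of_mem_left _ hH,
    Submodule.projection_apply_of_mem_right _ hV, add_zero]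

/-- The exterior covariant derivative
`d^H α (X_1, …, X_{k+1}) = dα(X_1^H, …, X_{k+1}^H)` of a form, with respect to a connection. -/
def covariantExtDeriv [LieGroup IG ∞ G] [FiniteDimensional ℝ EP] {π : P → M} (hP : IsPrincipalBundle IM IG G IP π)
    {θ : DForm IP P EG 1} (hθ : IsConnectionForm IG G IP θ) {k : ℕ} (α : DForm IP P EG k) :
    DForm IP P EG (k + 1) :=
  fun p ↦ (mextDeriv IP α p).compContinuousLinearMap (horizontalPart hP hθ p)

/-- The curvature form `Ω = d^H θ`. -/
def curvatureForm [LieGroup IG ∞ G] [FiniteDimensional ℝ EP] {π : P → M} (hP : IsPrincipalBundle IM IG G IP π)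
    {θ : DForm IP P EG 1} (hθ : IsConnectionForm IG G IP θ) : DForm IP P EG (1 + 1) :=
  covariantExtDeriv hP hθ θ

end Principal

end

open scoped Topology

/-! ### Mixed second derivatives of a map of two variables. -/

section MixedDerivatives

variable {E : Type*} [NormedAddCommGroup E] [NormedSpace ℝ E]
  {F : Type*} [NormedAddCommGroup F] [NormedSpace ℝ F]
  {W : Type*} [NormedAddCommGroup W] [NormedSpace ℝ W]

/-! Everything follows from one contraction formula, dθ(A^*, X) = -[A, θ(X)], valid for an arbitrary
tangent vector X (`IsConnectionForm.mextDeriv_fundamentalField`). Since X^H = X - (θ(X))^*,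
expanding dθ(X^H, Y^H) by bilinearity leaves dθ(X, Y) plus three terms with a fundamental vector in
the first slot. The formula turns these into [θ(X), θ(Y)] and two brackets that cancel, and [θ(X),
θ(Y)] is the value of ½[θ, θ] on (X, Y). No extension of vectors to vector fields and no splitting
into horizontal and vertical cases is needed.

The contraction formula is proved in charts. Let m(y, x) be the action and α the form, both in
coordinates, with base points y₀ and e. Differentiating θ(A^*) = A along X gives Dα(X)(A^*) +
α(D²m(X,0)(0,A)) = 0. Differentiating R_g^*θ = Ad_{g⁻¹}θ, evaluated on X, in g along A gives
Dα(A^*)(X) + α(D²m(X,0)(0,A)) = D(Ad_{g⁻¹})(A) θ(X). Subtracting removes the second derivative of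
the action and leaves dα(A^*, X) on the left.

It remains to see that B ↦ Ad_{g⁻¹}B has derivative -[A, B] at g = 1 along A
(`fderiv_adjointRep_inv`). With μ the multiplication in the chart at 1, both this derivative and the
bracket are antisymmetrizations of D²μ(A,0)(0,B): the bracket because left-invariant fields are
partial derivatives of μ, the adjoint representation because g(g⁻¹hg) = hg. -/

theorem fderiv_partial_right {f : E × F → W} {a : E} {b : F} (hf : DifferentiableAt ℝ f (a, b))
    (v : F) : fderiv ℝ (fun x ↦ f (a, x)) b v = fderiv ℝ f (a, b) (0, v) := by
  have h : HasFDerivAt (fun x : F ↦ (a, x)) ((0 : F →L[ℝ] E).prod (.id ℝ F)) b :=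
    (hasFDerivAt_const a b).prodMk (hasFDerivAt_id b)
  have h2 := (HasFDerivAt.comp (f := fun x : F ↦ (a, x)) b hf.hasFDerivAt h).fderiv
  exact (congrArg (fun L : F →L[ℝ] W ↦ L v) h2).trans (by simp)

theorem fderiv_partial_left {f : E × F → W} {a : E} {b : F} (hf : DifferentiableAt ℝ f (a, b))
    (u : E) : fderiv ℝ (fun y ↦ f (y, b)) a u = fderiv ℝ f (a, b) (u, 0) := by
  have h : HasFDerivAt (fun y : E ↦ (y, b)) ((ContinuousLinearMap.id ℝ E).prod (0 : E →L[ℝ] F)) a :=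
    (hasFDerivAt_id a).prodMk (hasFDerivAt_const b a)
  have h2 := (HasFDerivAt.comp (f := fun y : E ↦ (y, b)) a hf.hasFDerivAt h).fderiv
  exact (congrArg (fun L : E →L[ℝ] W ↦ L u) h2).trans (by simp)

/-- The derivative of a partial derivative in the second variable, along a moving vector. -/
theorem hasFDerivAt_partial_right {f : E × F → W} {a : E} {b : F} (hf : ContDiffAt ℝ ∞ f (a, b))
    {w : E → F} {w' : E →L[ℝ] F} (hw : HasFDerivAt w w' a) :
    HasFDerivAt (fun y ↦ fderiv ℝ (fun x ↦ f (y, x)) b (w y))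
      ((fderiv ℝ (fderiv ℝ f) (a, b)).flip (0, w a) ∘L ContinuousLinearMap.inl ℝ E F +
        fderiv ℝ (fun x ↦ f (a, x)) b ∘L w') a := by
  have h1 : ∀ᶠ q in 𝓝 (a, b), DifferentiableAt ℝ f q :=
    ((hf.of_le (m := 1) ENat.LEInfty.out).eventually (by simp)).mono
      fun q hq ↦ hq.differentiableAt (by simp)
  have hc : ContinuousAt (fun y : E ↦ (y, b)) a := by fun_prop
  have h2 : DifferentiableAt ℝ (fderiv ℝ f) (a, b) :=
    (hf.fderiv_right (m := 1) (by norm_num; exact ENat.LEInfty.out)).differentiableAt (by simp)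
  have h3 : HasFDerivAt (fun y : E ↦ (y, b)) (ContinuousLinearMap.inl ℝ E F) a :=
    (hasFDerivAt_id a).prodMk (hasFDerivAt_const b a)
  have h4 := (HasFDerivAt.comp (f := fun y : E ↦ (y, b)) a h2.hasFDerivAt h3).clm_apply
      ((hasFDerivAt_const (0 : E) a).prodMk hw)
  refine (h4.congr_fderiv ?_).congr_of_eventuallyEq
    ((hc.eventually h1).mono fun y hy ↦ fderiv_partial_right hy (w y))
  ext u
  simp [fderiv_partial_right h1.self_of_nhds, add_comm]

/-- The derivative of a partial derivative in the first variable: the mixed second derivatives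
agree. -/
theorem hasFDerivAt_partial_left {f : E × F → W} {a : E} {b : F} (hf : ContDiffAt ℝ ∞ f (a, b))
    (u : E) : HasFDerivAt (fun x ↦ fderiv ℝ (fun y ↦ f (y, x)) a u)
      (fderiv ℝ (fderiv ℝ f) (a, b) (u, 0) ∘L ContinuousLinearMap.inr ℝ E F) b := by
  have h1 : ∀ᶠ q in 𝓝 (a, b), DifferentiableAt ℝ f q :=
    ((hf.of_le (m := 1) ENat.LEInfty.out).eventually (by simp)).mono
      fun q hq ↦ hq.differentiableAt (by simp)
  have hc : ContinuousAt (fun x : F ↦ (a, x)) b := by fun_prop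
  have h2 : DifferentiableAt ℝ (fderiv ℝ f) (a, b) :=
    (hf.fderiv_right (m := 1) (by norm_num; exact ENat.LEInfty.out)).differentiableAt (by simp)
  have h3 : HasFDerivAt (fun x : F ↦ (a, x)) (ContinuousLinearMap.inr ℝ E F) b :=
    (hasFDerivAt_const a b).prodMk (hasFDerivAt_id b)
  have h4 : HasFDerivAt (fun x ↦ fderiv ℝ f (a, x) (u, 0))
      (fderiv ℝ (fderiv ℝ f) (a, b) (u, 0) ∘L ContinuousLinearMap.inr ℝ E F) b := by
    have := (HasFDerivAt.comp (f := fun x : F ↦ (a, x)) b h2.hasFDerivAt h3).clm_apply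
      (hasFDerivAt_const ((u, 0) : E × F) b)
    refine this.congr_fderiv ?_
    ext v
    -- Symmetry of D²f puts the first-variable direction first, which is the form in which
    -- `hasFDerivAt_partial_right` produces the same term.
    have hs := (hf.isSymmSndFDerivAt (by simpa using ENat.LEInfty.out)).eq (0, v) (u, 0)
    simpa using hs
  exact h4.congr_of_eventuallyEq ((hc.eventually h1).mono fun x hx ↦ fderiv_partial_left hx u)

end MixedDerivatives

/-! ### Differentials of maps between manifolds, read in charts. -/

section Charts

variable {E : Type*} [NormedAddCommGroup E] [NormedSpace ℝ E]
  {H : Type*} [TopologicalSpace H] (I : ModelWithCorners ℝ E H)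
  {M : Type*} [TopologicalSpace M] [ChartedSpace H M]
  {E' : Type*} [NormedAddCommGroup E'] [NormedSpace ℝ E']
  {H' : Type*} [TopologicalSpace H'] (I' : ModelWithCorners ℝ E' H')
  {M' : Type*} [TopologicalSpace M'] [ChartedSpace H' M']
  {E'' : Type*} [NormedAddCommGroup E''] [NormedSpace ℝ E'']
  {H'' : Type*} [TopologicalSpace H''] (I'' : ModelWithCorners ℝ E'' H'')
  {M'' : Type*} [TopologicalSpace M''] [ChartedSpace H'' M'']

/-- The differential of a map between manifolds, as a linear map between the model spaces. -/
noncomputable def modelDeriv (f : M → M') (x : M) : E →L[ℝ] E' :=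
  mfderiv I I' f x

/-- The differential at `y` of the inverse of the preferred chart around `x₀`. -/
noncomputable def chartSymmDeriv (x₀ : M) (y : E) : E →L[ℝ] E :=
  modelDeriv 𝓘(ℝ, E) I (extChartAt I x₀).symm y

theorem formInChart_apply_const {F : Type*} [NormedAddCommGroup F] [NormedSpace ℝ F]
    (α : DForm I M F 1) (x₀ : M) (y w : E) :
    formInChart I x₀ α y (fun _ ↦ w) =
      DForm.lin I α ((extChartAt I x₀).symm y) (chartSymmDeriv I x₀ y w) := rfl

theorem modelDeriv_comp {g : M' → M''} {f : M → M'} (x : M)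
    (hg : MDifferentiableAt I' I'' g (f x)) (hf : MDifferentiableAt I I' f x) :
    modelDeriv I I'' (fun y ↦ g (f y)) x = modelDeriv I' I'' g (f x) ∘L modelDeriv I I' f x :=
  mfderiv_comp x hg hf

theorem modelDeriv_eq_fderiv (f : E → E') (x : E) :
    modelDeriv 𝓘(ℝ, E) 𝓘(ℝ, E') f x = fderiv ℝ f x :=
  mfderiv_eq_fderiv

/-- The tangent space at `x` is identified with `E` through the preferred chart at `x` itself. Hence
chart differentials disappear from formulas at the base point. -/
theorem modelDeriv_extChartAt_self [IsManifold I ∞ M] (x : M) :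
    modelDeriv I 𝓘(ℝ, E) (extChartAt I x) x = ContinuousLinearMap.id ℝ E := by
  have : IsManifold I 1 M := IsManifold.of_le (n := ∞) ENat.LEInfty.out
  exact mfderiv_extChartAt_self

variable [I.Boundaryless] [IsManifold I ∞ M]

theorem mdifferentiableAt_extChartAt_symm {x₀ : M} {y : E} (hy : y ∈ (extChartAt I x₀).target) :
    MDifferentiableAt 𝓘(ℝ, E) I (extChartAt I x₀).symm y :=
  ((contMDiffOn_extChartAt_symm (n := ∞) x₀ y hy).contMDiffAt
    ((isOpen_extChartAt_target x₀).mem_nhds hy)).mdifferentiableAt (by simp)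

theorem chartSymmDeriv_comp_modelDeriv {x₀ z : M} (hz : z ∈ (extChartAt I x₀).source) :
    chartSymmDeriv I x₀ (extChartAt I x₀ z) ∘L modelDeriv I 𝓘(ℝ, E) (extChartAt I x₀) z =
      ContinuousLinearMap.id ℝ E := by
  have : IsManifold I 1 M := IsManifold.of_le (n := ∞) ENat.LEInfty.out
  have h := mfderivWithin_extChartAt_symm_comp_mfderiv_extChartAt' (I := I) hz
  rw [I.range_eq_univ, mfderivWithin_univ] at h
  exact h

theorem modelDeriv_comp_chartSymmDeriv {x₀ z : M} (hz : z ∈ (extChartAt I x₀).source) :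
    modelDeriv I 𝓘(ℝ, E) (extChartAt I x₀) z ∘L chartSymmDeriv I x₀ (extChartAt I x₀ z) =
      ContinuousLinearMap.id ℝ E := by
  have : IsManifold I 1 M := IsManifold.of_le (n := ∞) ENat.LEInfty.out
  have h := mfderiv_extChartAt_comp_mfderivWithin_extChartAt_symm' (I := I) hz
  rw [I.range_eq_univ, mfderivWithin_univ] at h
  exact h

theorem chartSymmDeriv_self (x : M) :
    chartSymmDeriv I x (extChartAt I x x) = ContinuousLinearMap.id ℝ E := by
  have h := chartSymmDeriv_comp_modelDeriv I (mem_extChartAt_source (I := I) x)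
  rwa [modelDeriv_extChartAt_self, ContinuousLinearMap.comp_id] at h

/-- The differential of the expression of `f` in charts, in terms of the differential of `f`. -/
theorem chartSymmDeriv_fderiv [I'.Boundaryless] [IsManifold I' ∞ M']
    {f : M → M'} {x₀ : M} {z₀ : M'} {x : M}
    (hx : x ∈ (extChartAt I x₀).source) (hfx : f x ∈ (extChartAt I' z₀).source)
    (hf : MDifferentiableAt I I' f x) (v : E) :
    chartSymmDeriv I' z₀ (extChartAt I' z₀ (f x))
        (fderiv ℝ (fun y ↦ extChartAt I' z₀ (f ((extChartAt I x₀).symm y)))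
          (extChartAt I x₀ x) v) =
      modelDeriv I I' f x (chartSymmDeriv I x₀ (extChartAt I x₀ x) v) := by
  have : IsManifold I' 1 M' := IsManifold.of_le (n := ∞) ENat.LEInfty.out
  have hl := (extChartAt I x₀).left_inv hx
  have h1 := mdifferentiableAt_extChartAt_symm I ((extChartAt I x₀).map_source hx)
  have h2 : MDifferentiableAt I' 𝓘(ℝ, E') (extChartAt I' z₀) (f x) :=
    mdifferentiableAt_extChartAt (by simpa using hfx)
  rw [← modelDeriv_eq_fderiv,
    modelDeriv_comp 𝓘(ℝ, E) I 𝓘(ℝ, E') (g := fun q ↦ extChartAt I' z₀ (f q)) _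
      (by rw [hl]; exact h2.comp x hf) h1, hl, modelDeriv_comp I I' 𝓘(ℝ, E') x h2 hf]
  exact congrArg (fun L : E' →L[ℝ] E' ↦ L (modelDeriv I I' f x
    (chartSymmDeriv I x₀ (extChartAt I x₀ x) v))) (chartSymmDeriv_comp_modelDeriv I' hfx)

end Charts

/-! ### Smooth maps of two variables in charts. -/

section ChartsProd

variable {E : Type*} [NormedAddCommGroup E] [NormedSpace ℝ E]
  {H : Type*} [TopologicalSpace H] {I : ModelWithCorners ℝ E H} [I.Boundaryless]
  {M : Type*} [TopologicalSpace M] [ChartedSpace H M] [IsManifold I ∞ M]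
  {E' : Type*} [NormedAddCommGroup E'] [NormedSpace ℝ E']
  {H' : Type*} [TopologicalSpace H'] {I' : ModelWithCorners ℝ E' H'} [I'.Boundaryless]
  {M' : Type*} [TopologicalSpace M'] [ChartedSpace H' M'] [IsManifold I' ∞ M']
  {E'' : Type*} [NormedAddCommGroup E''] [NormedSpace ℝ E'']
  {H'' : Type*} [TopologicalSpace H''] {I'' : ModelWithCorners ℝ E'' H''}
  {M'' : Type*} [TopologicalSpace M''] [ChartedSpace H'' M'']

/-- A smooth map of two variables is smooth when read in charts. -/
theorem contDiffAt_inCharts₂ {f : M × M' → M''} (hf : ContMDiff (I.prod I') I'' ∞ f)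
    {x₀ : M} {y₀ : M'} {z₀ : M''} (hz : f (x₀, y₀) = z₀) :
    ContDiffAt ℝ ∞ (fun q : E × E' ↦ extChartAt I'' z₀
      (f ((extChartAt I x₀).symm q.1, (extChartAt I' y₀).symm q.2)))
      (extChartAt I x₀ x₀, extChartAt I' y₀ y₀) := by
  subst hz
  rw [← contMDiffAt_iff_contDiffAt]
  have h1 : ContMDiffAt 𝓘(ℝ, E) I ∞ (extChartAt I x₀).symm (extChartAt I x₀ x₀) :=
    (contMDiffOn_extChartAt_symm x₀ _ (mem_extChartAt_target x₀)).contMDiffAt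
      (extChartAt_target_mem_nhds x₀)
  have h2 : ContMDiffAt 𝓘(ℝ, E') I' ∞ (extChartAt I' y₀).symm (extChartAt I' y₀ y₀) :=
    (contMDiffOn_extChartAt_symm y₀ _ (mem_extChartAt_target y₀)).contMDiffAt
      (extChartAt_target_mem_nhds y₀)
  let b : E × E' := (extChartAt I x₀ x₀, extChartAt I' y₀ y₀)
  have h3 : ContMDiffAt 𝓘(ℝ, E × E') (I.prod I') ∞
      (fun q : E × E' ↦ ((extChartAt I x₀).symm q.1, (extChartAt I' y₀).symm q.2)) b :=
    (ContMDiffAt.comp b h1 (contDiff_fst.contDiffAt.contMDiffAt)).prodMk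
      (ContMDiffAt.comp b h2 (contDiff_snd.contDiffAt.contMDiffAt))
  have h4 : ((extChartAt I x₀).symm b.1, (extChartAt I' y₀).symm b.2) = (x₀, y₀) :=
    Prod.ext (extChartAt_to_inv x₀) (extChartAt_to_inv y₀)
  have h5 : ContMDiffAt (I.prod I') 𝓘(ℝ, E'') ∞
      (fun q ↦ extChartAt I'' (f (x₀, y₀)) (f q)) (x₀, y₀) :=
    contMDiffAt_extChartAt.comp (x₀, y₀) (hf (x₀, y₀))
  exact ContMDiffAt.comp_of_eq (g := fun q ↦ extChartAt I'' (f (x₀, y₀)) (f q)) h5 h3 h4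

end ChartsProd

/-! ### The Lie bracket and the adjoint representation from the second derivative of multiplication.
-/

section LieGroupCharts

variable {EG : Type*} [NormedAddCommGroup EG] [NormedSpace ℝ EG]
  {HG : Type*} [TopologicalSpace HG] (IG : ModelWithCorners ℝ EG HG)
  {G : Type*} [TopologicalSpace G] [ChartedSpace HG G] [Group G]

variable (G) in
/-- The multiplication of a Lie group, read in the preferred chart around `1`. -/
noncomputable def mulInChart (q : EG × EG) : EG :=
  extChartAt IG (1 : G) ((extChartAt IG (1 : G)).symm q.1 * (extChartAt IG (1 : G)).symm q.2)

theorem fderiv_mulInChart_one [IG.Boundaryless] (v : EG) :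
    fderiv ℝ (fun x ↦ mulInChart IG G (extChartAt IG (1 : G) 1, x)) (extChartAt IG (1 : G) 1) v =
      v := by
  have h : (fun x ↦ mulInChart IG G (extChartAt IG (1 : G) 1, x)) =ᶠ[𝓝 (extChartAt IG (1 : G) 1)]
      id :=
    Filter.mem_of_superset (extChartAt_target_mem_nhds 1) fun x hx ↦ by
      change extChartAt IG (1 : G) ((extChartAt IG (1 : G)).symm (extChartAt IG (1 : G) 1) * _) = x
      rw [extChartAt_to_inv, one_mul, (extChartAt IG (1 : G)).right_inv hx]
  rw [h.fderiv_eq, fderiv_id, ContinuousLinearMap.id_apply]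

variable [LieGroup IG ∞ G]

theorem mdifferentiable_mul_left' (g : G) : MDifferentiable IG IG (fun h : G ↦ g * h) :=
  (contMDiff_mul_left (n := ∞)).mdifferentiable (by simp)

theorem mdifferentiable_mul_right' (g : G) : MDifferentiable IG IG (fun h : G ↦ h * g) :=
  (contMDiff_mul_right (n := ∞)).mdifferentiable (by simp)

/-- Differentiate g(g⁻¹hg) = hg at h = 1. This replaces Ad by left and right translations, whose
dependence on g is that of the multiplication map. -/
theorem modelDeriv_mul_left_adjointRep (g : G) (B : EG) :
    modelDeriv IG IG (fun h : G ↦ g * h) 1 (adjointRep IG g⁻¹ B) =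
      modelDeriv IG IG (fun h : G ↦ h * g) 1 B := by
  have h1 : MDifferentiable IG IG (fun h : G ↦ g⁻¹ * h * g⁻¹⁻¹) :=
    (mdifferentiable_mul_right' IG g⁻¹⁻¹).comp (mdifferentiable_mul_left' IG g⁻¹)
  have h2 := modelDeriv_comp IG IG IG (1 : G) (mdifferentiable_mul_left' IG g _) (h1 1)
  rw [show (fun h : G ↦ g * (g⁻¹ * h * g⁻¹⁻¹)) = fun h ↦ h * g by funext h; group,
    show g⁻¹ * 1 * g⁻¹⁻¹ = 1 by group] at h2
  exact (congrArg (fun L : EG →L[ℝ] EG ↦ L B) h2).symm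

variable [IG.Boundaryless]

theorem chartSymmDeriv_mul_left {g : G} (hg : g ∈ (extChartAt IG (1 : G)).source) (v : EG) :
    chartSymmDeriv IG (1 : G) (extChartAt IG 1 g)
      (fderiv ℝ (fun y ↦ extChartAt IG (1 : G) (g * (extChartAt IG (1 : G)).symm y))
        (extChartAt IG (1 : G) 1) v) = modelDeriv IG IG (fun h : G ↦ g * h) 1 v := by
  have h := chartSymmDeriv_fderiv IG IG (f := fun h : G ↦ g * h) (x₀ := 1) (z₀ := 1) (x := 1)
    (mem_extChartAt_source 1) (by simpa using hg) (mdifferentiable_mul_left' IG g 1) v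
  rwa [chartSymmDeriv_self, ContinuousLinearMap.id_apply, mul_one] at h

theorem chartSymmDeriv_mul_right {g : G} (hg : g ∈ (extChartAt IG (1 : G)).source) (v : EG) :
    chartSymmDeriv IG (1 : G) (extChartAt IG 1 g)
      (fderiv ℝ (fun y ↦ extChartAt IG (1 : G) ((extChartAt IG (1 : G)).symm y * g))
        (extChartAt IG (1 : G) 1) v) = modelDeriv IG IG (fun h : G ↦ h * g) 1 v := by
  have h := chartSymmDeriv_fderiv IG IG (f := fun h : G ↦ h * g) (x₀ := 1) (z₀ := 1) (x := 1)
    (mem_extChartAt_source 1) (by simpa using hg) (mdifferentiable_mul_right' IG g 1) v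
  rwa [chartSymmDeriv_self, ContinuousLinearMap.id_apply, one_mul] at h

theorem fderiv_mul_left_adjointRep {g : G} (hg : g ∈ (extChartAt IG (1 : G)).source) (B : EG) :
    fderiv ℝ (fun y ↦ extChartAt IG (1 : G) (g * (extChartAt IG (1 : G)).symm y))
        (extChartAt IG (1 : G) 1) (adjointRep IG g⁻¹ B) =
      fderiv ℝ (fun y ↦ extChartAt IG (1 : G) ((extChartAt IG (1 : G)).symm y * g))
        (extChartAt IG (1 : G) 1) B := by
  have h := (chartSymmDeriv_mul_left IG hg (adjointRep IG g⁻¹ B)).trans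
    ((modelDeriv_mul_left_adjointRep IG g B).trans (chartSymmDeriv_mul_right IG hg B).symm)
  -- The differential of the inverse chart is injective, so it can be cancelled from the equality of
  -- tangent vectors at g.
  have hi : ∀ w, modelDeriv IG 𝓘(ℝ, EG) (extChartAt IG (1 : G)) g
      (chartSymmDeriv IG (1 : G) (extChartAt IG 1 g) w) = w := fun w ↦
    congrArg (fun L : EG →L[ℝ] EG ↦ L w) (modelDeriv_comp_chartSymmDeriv IG hg)
  rw [← hi (fderiv ℝ _ _ _), h, hi]

variable (G) in
theorem contDiffAt_mulInChart : ContDiffAt ℝ ∞ (mulInChart IG G)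
    (extChartAt IG (1 : G) 1, extChartAt IG (1 : G) 1) :=
  contDiffAt_inCharts₂ (f := fun q : G × G ↦ q.1 * q.2) (contMDiff_mul IG ∞) (one_mul 1)

/-- A left-invariant vector field, read in the preferred chart around `1`. -/
theorem mpullbackWithin_mulInvariantVectorField (v : GroupLieAlgebra IG G) {x : EG}
    (hx : x ∈ (extChartAt IG (1 : G)).target) :
    VectorField.mpullbackWithin 𝓘(ℝ, EG) IG (extChartAt IG (1 : G)).symm
        (mulInvariantVectorField (I := IG) v) (Set.range IG) x =
      fderiv ℝ (fun y ↦ mulInChart IG G (x, y)) (extChartAt IG (1 : G) 1) v := by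
  have : IsManifold IG 1 G := IsManifold.of_le (n := ∞) ENat.LEInfty.out
  have hg := (extChartAt IG (1 : G)).map_target hx
  have h := chartSymmDeriv_mul_left IG hg v
  rw [(extChartAt IG (1 : G)).right_inv hx] at h
  -- The pullback applies the inverse of the differential of the inverse chart; moving it across
  -- leaves the chart formula for left translation.
  refine ((isInvertible_mfderivWithin_extChartAt_symm hx).inverse_apply_eq).2
    (Eq.trans ?_ (h.symm.trans ?_))
  · rfl
  · rw [IG.range_eq_univ, mfderivWithin_univ]
    rfl

variable (G) in
/-- The bracket of `𝔤` is the antisymmetrization of the second-order part of the multiplication. -/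
theorem lieBracketL_eq_fderiv_fderiv_mulInChart [FiniteDimensional ℝ EG] (a b : EG) :
    lieBracketL IG G a b =
      fderiv ℝ (fderiv ℝ (mulInChart IG G)) (extChartAt IG (1 : G) 1, extChartAt IG (1 : G) 1)
          (a, 0) (0, b) -
        fderiv ℝ (fderiv ℝ (mulInChart IG G)) (extChartAt IG (1 : G) 1, extChartAt IG (1 : G) 1)
          (b, 0) (0, a) := by
  set e := extChartAt IG (1 : G) 1 with he
  let X : EG → EG → EG := fun v x ↦ fderiv ℝ (fun y ↦ mulInChart IG G (x, y)) e v
  let V : EG → EG → EG := fun v ↦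
    VectorField.mpullbackWithin 𝓘(ℝ, EG) IG (extChartAt IG (1 : G)).symm
      (mulInvariantVectorField (I := IG) (v : GroupLieAlgebra IG G)) (Set.range IG)
  have hX : ∀ v, V v =ᶠ[𝓝 e] X v := fun v ↦ Filter.mem_of_superset (extChartAt_target_mem_nhds 1)
    fun x hx ↦ mpullbackWithin_mulInvariantVectorField IG v hx
  have hX0 : ∀ v, X v e = v := fderiv_mulInChart_one IG
  have hXd : ∀ u v : EG, fderiv ℝ (X v) e u =
      fderiv ℝ (fderiv ℝ (mulInChart IG G)) (e, e) (u, 0) (0, v) := fun u v ↦ by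
    have h := hasFDerivAt_partial_right (contDiffAt_mulInChart IG G) (hasFDerivAt_const v e)
    rw [h.fderiv]
    simp [he]
  -- By definition the bracket on the manifold is the bracket of the fields in the chart at 1,
  -- carried back by the chart differential, which is the identity there.
  have h1 : lieBracketL IG G a b =
      (modelDeriv IG 𝓘(ℝ, EG) (extChartAt IG (1 : G)) 1).inverse
        (VectorField.lieBracketWithin ℝ (V a) (V b)
          ((extChartAt IG (1 : G)).symm ⁻¹' Set.univ ∩ Set.range IG) e) := rfl
  rw [h1, modelDeriv_extChartAt_self, ContinuousLinearMap.inverse_id, ContinuousLinearMap.id_apply,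
    IG.range_eq_univ, Set.preimage_univ, Set.univ_inter, VectorField.lieBracketWithin_univ]
  refine ((hX a).lieBracket_vectorField_eq (hX b)).trans ?_
  rw [VectorField.lieBracket, hX0, hX0, hXd, hXd]

variable (G) in
-- Differentiate ∂₂μ(x, e)(Ad_{x⁻¹}B) = ∂₁μ(e, x)(B) at x = e along A. As ∂₂μ(e, e) is the identity,
-- the derivative of Ad is D²μ(B,0)(0,A) - D²μ(A,0)(0,B). Smoothness of Ad is not proved:
-- differentiability is a hypothesis, which the equivariance of a connection form will supply.
theorem fderiv_adjointRep_inv [FiniteDimensional ℝ EG] (A B : EG)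
    (hd : DifferentiableAt ℝ
      (fun x ↦ adjointRep IG ((extChartAt IG (1 : G)).symm x)⁻¹ B) (extChartAt IG (1 : G) 1)) :
    fderiv ℝ (fun x ↦ adjointRep IG ((extChartAt IG (1 : G)).symm x)⁻¹ B)
      (extChartAt IG (1 : G) 1) A = -lieBracketL IG G A B := by
  set e := extChartAt IG (1 : G) 1 with he
  have h1 := hasFDerivAt_partial_right (contDiffAt_mulInChart IG G) hd.hasFDerivAt
  have h2 := hasFDerivAt_partial_left (contDiffAt_mulInChart IG G) B
  have h3 := h1.unique (h2.congr_of_eventuallyEq (Filter.mem_of_superset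
    (extChartAt_target_mem_nhds 1) fun x hx ↦
      fderiv_mul_left_adjointRep IG ((extChartAt IG (1 : G)).map_target hx) B))
  have h4 := congrArg (fun L : EG →L[ℝ] EG ↦ L A) h3
  have h0 : adjointRep IG ((extChartAt IG (1 : G)).symm e)⁻¹ B = B := by
    rw [he, extChartAt_to_inv, inv_one]
    have : (fun h : G ↦ 1 * h * 1⁻¹) = id := by funext h; simp
    rw [adjointRep, this, mfderiv_id]
    rfl
  simp only [add_apply, ContinuousLinearMap.comp_apply,
    ContinuousLinearMap.flip_apply, ContinuousLinearMap.inl_apply, ContinuousLinearMap.inr_apply,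
    ← he, h0] at h4
  rw [fderiv_mulInChart_one] at h4
  rw [lieBracketL_eq_fderiv_fderiv_mulInChart, neg_sub]
  exact eq_sub_of_add_eq' h4

end LieGroupCharts

/-! ### Calculus of 1-forms and 2-forms on a vector space. -/

section OneForms

variable {E : Type*} [NormedAddCommGroup E] [NormedSpace ℝ E]
  {F : Type*} [NormedAddCommGroup F] [NormedSpace ℝ F]
  {X : Type*} [NormedAddCommGroup X] [NormedSpace ℝ X]

/-- The product rule for a `1`-form evaluated on a vector along a map. -/
theorem hasFDerivAt_oneForm_apply {α : E → E [⋀^Fin 1]→L[ℝ] F} {c w : X → E} {t : X}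
    {c' w' : X →L[ℝ] E} {y : E} (hy : c t = y)
    (hα : DifferentiableAt ℝ α y) (hc : HasFDerivAt c c' t) (hw : HasFDerivAt w w' t) :
    ∃ L : X →L[ℝ] F, HasFDerivAt (fun s ↦ α (c s) (fun _ ↦ w s)) L t ∧
      ∀ u, L u = fderiv ℝ α y (c' u) (fun _ ↦ w t) + α y (fun _ ↦ w' u) := by
  subst hy
  have h := (hα.hasFDerivAt.comp t hc).continuousAlternatingMap_apply (g := fun _ s ↦ w s)
    (g' := fun _ ↦ w') (fun _ ↦ hw)
  refine ⟨_, h, fun u ↦ ?_⟩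
  have h1 : Function.update (fun _ : Fin 1 ↦ w t) 0 (w' u) = fun _ ↦ w' u := by
    funext i
    rw [Subsingleton.elim i 0, Function.update_self]
  simp [h1]

theorem extDeriv_oneForm_apply (α : E → E [⋀^Fin 1]→L[ℝ] F) (y u v : E) :
    extDeriv α y ![u, v] = fderiv ℝ α y u (fun _ ↦ v) - fderiv ℝ α y v (fun _ ↦ u) := by
  have h0 : Fin.removeNth 0 ![u, v] = fun _ ↦ v := by
    funext i
    rw [Subsingleton.elim i 0]
    rfl
  have h1 : Fin.removeNth 1 ![u, v] = fun _ ↦ u := by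
    funext i
    rw [Subsingleton.elim i 0]
    rfl
  rw [extDeriv, ContinuousAlternatingMap.alternatizeUncurryFin_apply, Fin.sum_univ_two, h0, h1]
  simp [sub_eq_add_neg]

/-- Expansion of a `2`-form on differences, with the correction terms in the first slot. -/
theorem ContinuousAlternatingMap.map_sub_sub (f : E [⋀^Fin 2]→L[ℝ] F) (u v a b : E) :
    f ![u - a, v - b] = f ![u, v] - f ![a, v] + f ![b, u] - f ![b, a] := by
  have h1 : ∀ x y z : E, f ![x - y, z] = f ![x, z] - f ![y, z] := fun x y z ↦ by simp
  have h2 : ∀ x y : E, f ![x, y] = -f ![y, x] := fun x y ↦ by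
    refine Eq.trans ?_ (f.toAlternatingMap.map_swap ![y, x] (i := 0) (j := 1) (by simp))
    refine congrArg f ?_
    funext i
    fin_cases i <;> rfl
  rw [h1, h2 u, h1, h2 a, h1, h2 v u, h2 v a]
  abel

end OneForms

/-! ### The contraction of dθ with a fundamental field. -/

section Connections

variable {EM : Type*} [NormedAddCommGroup EM] [NormedSpace ℝ EM]
  {HM : Type*} [TopologicalSpace HM] {IM : ModelWithCorners ℝ EM HM}
  {M : Type*} [TopologicalSpace M] [ChartedSpace HM M]
  {EG : Type*} [NormedAddCommGroup EG] [NormedSpace ℝ EG]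
  {HG : Type*} [TopologicalSpace HG] {IG : ModelWithCorners ℝ EG HG}
  {G : Type*} [TopologicalSpace G] [ChartedSpace HG G] [Group G]
  {EP : Type*} [NormedAddCommGroup EP] [NormedSpace ℝ EP]
  {HP : Type*} [TopologicalSpace HP] {IP : ModelWithCorners ℝ EP HP}
  {P : Type*} [TopologicalSpace P] [ChartedSpace HP P] [MulAction Gᵐᵒᵖ P]

variable (IG G IP) in
/-- The action of `G` on `P`, read in the preferred charts around `p` and `1`. -/
noncomputable def actInChart (p : P) (q : EP × EG) : EP :=
  extChartAt IP p
    (MulOpposite.op ((extChartAt IG (1 : G)).symm q.2) • (extChartAt IP p).symm q.1)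

theorem mextDeriv_eq_extDeriv [IsManifold IP ∞ P] {F : Type*} [NormedAddCommGroup F] [NormedSpace ℝ F] {k : ℕ}
    (α : DForm IP P F k) (p : P) :
    mextDeriv IP α p = extDeriv (formInChart IP p α) (extChartAt IP p p) := by
  have h : mextDeriv IP α p = (extDeriv (formInChart IP p α)
      (extChartAt IP p p)).compContinuousLinearMap
        (modelDeriv IP 𝓘(ℝ, EP) (extChartAt IP p) p) := rfl
  rw [h, modelDeriv_extChartAt_self]
  rfl

variable [IP.Boundaryless] [IsManifold IP ∞ P] {π : P → M}

theorem IsPrincipalBundle.chartSymmDeriv_translation (hP : IsPrincipalBundle IM IG G IP π) {p : P} {g : G}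
    (hg : MulOpposite.op g • p ∈ (extChartAt IP p).source) (X : EP) :
    chartSymmDeriv IP p (extChartAt IP p (MulOpposite.op g • p))
      (fderiv ℝ (fun y ↦ extChartAt IP p (MulOpposite.op g • (extChartAt IP p).symm y))
        (extChartAt IP p p) X) =
      modelDeriv IP IP (fun q : P ↦ MulOpposite.op g • q) p X := by
  have hd : ContMDiff IP IP ∞ (fun q : P ↦ MulOpposite.op g • q) :=
    hP.contMDiff_act.comp (contMDiff_id.prodMk contMDiff_const)
  have h := chartSymmDeriv_fderiv IP IP (f := fun q : P ↦ MulOpposite.op g • q) (x₀ := p) (z₀ := p)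
    (mem_extChartAt_source p) hg (hd.mdifferentiable (by simp) p) X
  rwa [chartSymmDeriv_self, ContinuousLinearMap.id_apply] at h

variable [IG.Boundaryless] [LieGroup IG ∞ G]

theorem IsPrincipalBundle.contDiffAt_actInChart (hP : IsPrincipalBundle IM IG G IP π) (p : P) :
    ContDiffAt ℝ ∞ (actInChart IG G IP p) (extChartAt IP p p, extChartAt IG (1 : G) 1) :=
  contDiffAt_inCharts₂ hP.contMDiff_act (one_smul Gᵐᵒᵖ p)

theorem IsPrincipalBundle.chartSymmDeriv_orbit (hP : IsPrincipalBundle IM IG G IP π) {p : P} {y : EP} (hy : y ∈ (extChartAt IP p).target)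
    (A : EG) :
    chartSymmDeriv IP p y
      (fderiv ℝ (fun x ↦ actInChart IG G IP p (y, x)) (extChartAt IG (1 : G) 1) A) =
        fundamentalField IG G IP A ((extChartAt IP p).symm y) := by
  have hq := (extChartAt IP p).map_target hy
  have h := chartSymmDeriv_fderiv IG IP
    (f := fun g : G ↦ MulOpposite.op g • (extChartAt IP p).symm y) (x₀ := 1) (z₀ := p) (x := 1)
    (mem_extChartAt_source 1) (by simpa using hq)
    ((hP.contMDiff_orbit _).mdifferentiable (by simp) 1) A
  rw [chartSymmDeriv_self, ContinuousLinearMap.id_apply, MulOpposite.op_one, one_smul,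
    (extChartAt IP p).right_inv hy] at h
  exact h

/-- The contraction of `dθ` with a fundamental field: `dθ(A^*, X) = -[A, θ(X)]`. -/
theorem IsConnectionForm.mextDeriv_fundamentalField [FiniteDimensional ℝ EG]
    {θ : DForm IP P EG 1} (hθ : IsConnectionForm IG G IP θ)
    (hP : IsPrincipalBundle IM IG G IP π) (p : P) (A : EG) (X : EP) :
    mextDeriv IP θ p ![fundamentalField IG G IP A p, X] =
      -lieBracketL IG G A (DForm.lin IP θ p X) := by
  set y₀ := extChartAt IP p p with hy₀
  set e := extChartAt IG (1 : G) 1 with he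
  let α : EP → EP [⋀^Fin 1]→L[ℝ] EG := formInChart IP p θ
  let m : EP × EG → EP := actInChart IG G IP p
  have hm : ContDiffAt ℝ ∞ m (y₀, e) := hP.contDiffAt_actInChart p
  have hα : DifferentiableAt ℝ α y₀ :=
    ((hθ.smooth p).contDiffAt (extChartAt_target_mem_nhds p)).differentiableAt (by simp)
  have hA : fderiv ℝ (fun x ↦ m (y₀, x)) e A = fundamentalField IG G IP A p := by
    have h := hP.chartSymmDeriv_orbit (mem_extChartAt_target p) A
    rw [chartSymmDeriv_self, extChartAt_to_inv] at h
    exact h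
  have hid : (fun y ↦ m (y, e)) =ᶠ[𝓝 y₀] id :=
    Filter.mem_of_superset (extChartAt_target_mem_nhds p) fun y hy ↦ by
      change extChartAt IP p (MulOpposite.op ((extChartAt IG (1 : G)).symm e) •
        (extChartAt IP p).symm y) = y
      rw [he, extChartAt_to_inv, MulOpposite.op_one, one_smul, (extChartAt IP p).right_inv hy]
  have hX : fderiv ℝ (fun y ↦ m (y, e)) y₀ X = X := by
    rw [hid.fderiv_eq, fderiv_id, ContinuousLinearMap.id_apply]
  have hcurve : HasFDerivAt (fun x ↦ m (y₀, x)) (fderiv ℝ (fun x ↦ m (y₀, x)) e) e :=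
    (DifferentiableAt.comp (f := fun x : EG ↦ (y₀, x)) e (hm.differentiableAt (by simp))
      (by fun_prop)).hasFDerivAt
  -- the normalization `θ(A^*) = A`, differentiated along `X`
  obtain ⟨L₁, hL₁, hL₁'⟩ := hasFDerivAt_oneForm_apply (c := id) (t := y₀) (y := y₀) rfl hα (hasFDerivAt_id y₀)
    (hasFDerivAt_partial_right hm (hasFDerivAt_const A y₀))
  have h1 : (fun y ↦ α y (fun _ ↦ fderiv ℝ (fun x ↦ m (y, x)) e A)) =ᶠ[𝓝 y₀] fun _ ↦ A :=
    Filter.mem_of_superset (extChartAt_target_mem_nhds p) fun y hy ↦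
      (congrArg (fun v ↦ DForm.lin IP θ ((extChartAt IP p).symm y) v)
        (hP.chartSymmDeriv_orbit hy A)).trans (hθ.apply_fundamentalField A _)
  have h1' : L₁ X = 0 := by
    rw [hL₁.unique ((hasFDerivAt_const A y₀).congr_of_eventuallyEq h1)]
    rfl
  rw [hL₁', hA] at h1'
  -- the equivariance of `θ`, differentiated along `A`
  obtain ⟨L₂, hL₂, hL₂'⟩ := hasFDerivAt_oneForm_apply (c := fun x ↦ m (y₀, x)) (y := y₀) hid.self_of_nhds hα hcurve
    (hasFDerivAt_partial_left hm X)
  have hcont : ContinuousAt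
      (fun x ↦ MulOpposite.op ((extChartAt IG (1 : G)).symm x) • p) e :=
    ContinuousAt.comp (g := fun g : G ↦ MulOpposite.op g • p)
      (hP.contMDiff_orbit p).continuous.continuousAt (continuousAt_extChartAt_symm 1)
  have h2 : (fun x ↦ α (m (y₀, x)) (fun _ ↦ fderiv ℝ (fun y ↦ m (y, x)) y₀ X)) =ᶠ[𝓝 e]
      fun x ↦ adjointRep IG ((extChartAt IG (1 : G)).symm x)⁻¹ (DForm.lin IP θ p X) := by
    -- Equivariance can be read in the chart around p only while p · g stays in the domain of that
    -- chart.
    have hs : ∀ᶠ x in 𝓝 e, MulOpposite.op ((extChartAt IG (1 : G)).symm x) • p ∈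
        (extChartAt IP p).source := by
      refine hcont.eventually (extChartAt_source_mem_nhds' ?_)
      change MulOpposite.op ((extChartAt IG (1 : G)).symm (extChartAt IG (1 : G) 1)) • p ∈ _
      rw [extChartAt_to_inv, MulOpposite.op_one, one_smul]
      exact mem_extChartAt_source p
    filter_upwards [hs] with x hx
    have hmx : m (y₀, x) =
        extChartAt IP p (MulOpposite.op ((extChartAt IG (1 : G)).symm x) • p) := by
      change extChartAt IP p (MulOpposite.op ((extChartAt IG (1 : G)).symm x) •
        (extChartAt IP p).symm (extChartAt IP p p)) = _
      rw [extChartAt_to_inv]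
    rw [hmx, formInChart_apply_const]
    refine (congrArg (fun v ↦ DForm.lin IP θ _ v) (hP.chartSymmDeriv_translation hx X)).trans ?_
    rw [(extChartAt IP p).left_inv hx]
    exact hθ.equivariant _ p X
  -- The map x ↦ Ad_{x⁻¹}θ(X) agrees near e with the differentiable left side of the equivariance,
  -- hence is itself differentiable at e.
  have h2' := fderiv_adjointRep_inv IG G A (DForm.lin IP θ p X)
    (hL₂.congr_of_eventuallyEq h2.symm).differentiableAt
  rw [(hL₂.congr_of_eventuallyEq h2.symm).fderiv, hL₂', hA, hX] at h2'
  have h3 : mextDeriv IP θ p ![fundamentalField IG G IP A p, X] =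
      fderiv ℝ α y₀ (fundamentalField IG G IP A p) (fun _ ↦ X) -
        fderiv ℝ α y₀ X (fun _ ↦ fundamentalField IG G IP A p) := by
    rw [mextDeriv_eq_extDeriv]
    exact extDeriv_oneForm_apply α y₀ _ X
  have h4 : fderiv ℝ α y₀ X (fun _ ↦ fundamentalField IG G IP A p) =
      -α y₀ (fun _ ↦ fderiv ℝ (fderiv ℝ m) (y₀, e) (X, 0) (0, A)) := by
    refine eq_neg_of_add_eq_zero_left (Eq.trans ?_ h1')
    simp only [ContinuousLinearMap.comp_zero, add_zero]
    rfl
  -- The same term α(D²m(X,0)(0,A)) now stands on both sides.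
  rw [h3, ← h2', h4, sub_neg_eq_add]
  rfl

end Connections

/-! ### The bracket of θ with itself, and the structure equation. -/

theorem lieBracketL_skew {EG : Type*} [NormedAddCommGroup EG] [NormedSpace ℝ EG]
    [FiniteDimensional ℝ EG]
    {HG : Type*} [TopologicalSpace HG] (IG : ModelWithCorners ℝ EG HG) [IG.Boundaryless]
    (G : Type*) [TopologicalSpace G] [ChartedSpace HG G] [Group G] [LieGroup IG ∞ G] (a b : EG) :
    -lieBracketL IG G b a = lieBracketL IG G a b := by
  simp only [lieBracketL_eq_fderiv_fderiv_mulInChart, neg_sub]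

/-- The sum over S₂ has two terms, equal because the sign of the swap compensates the antisymmetry
of the bracket; the factor ½ removes the repetition. -/
theorem half_alternatingBracket_self {EG : Type*} [NormedAddCommGroup EG] [NormedSpace ℝ EG]
    [FiniteDimensional ℝ EG]
    {HG : Type*} [TopologicalSpace HG] (IG : ModelWithCorners ℝ EG HG) [IG.Boundaryless]
    (G : Type*) [TopologicalSpace G] [ChartedSpace HG G] [Group G] [LieGroup IG ∞ G]
    {V : Type*} [AddCommGroup V] [Module ℝ V] [TopologicalSpace V]
    (α : V [⋀^Fin 1]→L[ℝ] EG) (v : Fin (1 + 1) → V) :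
    (1 / 2 : ℝ) • alternatingBracket IG G α α v =
      lieBracketL IG G (α fun _ ↦ v 0) (α fun _ ↦ v 1) := by
  have h : ∀ σ : Equiv.Perm (Fin (1 + 1)),
      lieBracketL IG G (α fun a ↦ v (σ (Fin.castAdd 1 a))) (α fun b ↦ v (σ (Fin.natAdd 1 b))) =
        lieBracketL IG G (α fun _ ↦ v (σ 0)) (α fun _ ↦ v (σ 1)) := fun σ ↦ by
    congr 3
    · funext a
      rw [Subsingleton.elim a 0]
      rfl
    · funext a
      rw [Subsingleton.elim a 0]
      rfl
  rw [alternatingBracket_apply]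
  simp only [h]
  have hu : (Finset.univ : Finset (Equiv.Perm (Fin (1 + 1)))) = {1, Equiv.swap 0 1} := by decide
  rw [hu, Finset.sum_pair (by decide), Equiv.Perm.sign_swap (by decide)]
  simp [lieBracketL_skew, ← two_smul ℝ]

theorem mainTheorem5
    {EM : Type*} [NormedAddCommGroup EM] [NormedSpace ℝ EM] [FiniteDimensional ℝ EM]
    {HM : Type*} [TopologicalSpace HM] (IM : ModelWithCorners ℝ EM HM) [IM.Boundaryless]
    {M : Type*} [TopologicalSpace M] [ChartedSpace HM M] [IsManifold IM ∞ M] [T2Space M]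
    {EG : Type*} [NormedAddCommGroup EG] [NormedSpace ℝ EG] [FiniteDimensional ℝ EG]
    {HG : Type*} [TopologicalSpace HG] (IG : ModelWithCorners ℝ EG HG) [IG.Boundaryless]
    (G : Type*) [TopologicalSpace G] [ChartedSpace HG G] [Group G] [LieGroup IG ∞ G] [T2Space G]
    {EP : Type*} [NormedAddCommGroup EP] [NormedSpace ℝ EP] [FiniteDimensional ℝ EP]
    {HP : Type*} [TopologicalSpace HP] (IP : ModelWithCorners ℝ EP HP) [IP.Boundaryless]
    {P : Type*} [TopologicalSpace P] [ChartedSpace HP P] [IsManifold IP ∞ P] [T2Space P]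
    [MulAction Gᵐᵒᵖ P] (π : P → M) (hP : IsPrincipalBundle IM IG G IP π)
    (θ : DForm IP P EG 1) (hθ : IsConnectionForm IG G IP θ) :
    curvatureForm hP hθ =
      fun p ↦ mextDeriv IP θ p + (1 / 2 : ℝ) • formBracket IG G IP θ θ p := by
  funext p
  refine ContinuousAlternatingMap.ext fun v ↦ ?_
  let a : Fin (1 + 1) → EG := fun i ↦ DForm.lin IP θ p (v i)
  -- Tangent vectors at p are regarded as elements of the model space, to which they are
  -- definitionally equal, so that the linear algebra takes place in `EP`.
  let w : Fin (1 + 1) → EP := v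
  let F : EG → EP := fun A ↦ fundamentalField IG G IP A p
  let β : EP [⋀^Fin 2]→L[ℝ] EG := mextDeriv IP θ p
  have hv : ∀ u : Fin 2 → EP, u = ![u 0, u 1] := fun u ↦ by
    funext i
    fin_cases i <;> rfl
  have hβ : ∀ (A : EG) (X : EP), β ![F A, X] = -lieBracketL IG G A (DForm.lin IP θ p X) :=
    hθ.mextDeriv_fundamentalField hP p
  have h1 : curvatureForm hP hθ p v = β ![w 0 - F (a 0), w 1 - F (a 1)] := by
    refine congrArg β ((hv _).trans ?_)
    have hH := horizontalPart_apply hP hθ p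
    exact congrArg₂ (fun x y : EP ↦ ![x, y]) (hH (v 0)) (hH (v 1))
  have h2 : (mextDeriv IP θ p + (1 / 2 : ℝ) • formBracket IG G IP θ θ p) v =
      β ![w 0, w 1] + lieBracketL IG G (a 0) (a 1) :=
    congrArg₂ (fun x y : EG ↦ x + y) (congrArg β (hv v)) (half_alternatingBracket_self IG G (θ p) v)
  have ha : DForm.lin IP θ p (F (a 0)) = a 0 := hθ.apply_fundamentalField (a 0) p
  refine h1.trans (Eq.trans ?_ h2.symm)
  -- The three corrections are [a₀, a₁], -[a₁, a₀] and [a₁, a₀]; in the last one the second slot is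
  -- (a₀)^*, on which θ takes the value a₀.
  rw [β.map_sub_sub, hβ, hβ, hβ, ha]
  change _ - -lieBracketL IG G (a 0) (a 1) + -lieBracketL IG G (a 1) (a 0) -
    -lieBracketL IG G (a 1) (a 0) = _
  abel
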